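/- **Setting.** Let $G$ be the group of affine maps $z\mapsto az+b$ ($a>0$, $b\in\mathbb R$) of the hyperbolic upper half plane $\mathbb H_2$, $R_a(z)=az$, $R=R_2$, $S(z)=z+1$. Let $P$ be the convex hyperbolic pentagon with vertices $i,\ \tfrac12+i,\ 1+i,\ 1+2i,\ 2i$, and, for $w\in\{1,\dots,r\}^{\mathbb Z}$, let $\mathcal P(w)=\{R^qS^n(P_{w_{-q}}) : n,q\in\mathbb Z\}$, where $P_c$ is $P$ with colour $c$. Let $X_w$ be the continuous hull of $\mathcal P(w)$: the space of tilings that are limits of tilings in $G\cdot\mathcal P(w)$ for the tiling metric (two tilings are close if, up to an element of $G$ close to the identity, they agree on a large ball centred at $i$). Let $\mathcal A$ be the Fréchet algebra of functions $X_w\to\mathbb C$ which are smooth along the $G$-orbits and whose leafwise derivatives of all orders are continuous on $X_w$, with semi-norms $\sup|X^kY^lf|$. Here $(\beta^0_tf)(T)=f(T+t)$, $(\beta^1_tf)(T)=f(R_{2^t}T)$, and $X$, $Y$ are the derivatives at $t=0$ of $\beta^0_t$, $\beta^1_t$; thus $Y\beta^0_t=\beta^0_tY-t\ln 2\,\beta^0_tX$.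 The smooth crossed product $\mathcal A\rtimes_{\beta^0}\mathbb R$ consists of the smooth $f:\mathbb R\to\mathcal A$ with $\sup_t(1+t^2)^{k/2}\|f^{(m)}(t)\|<\infty$ for all $k,m$ and every semi-norm, with product $(f*g)(t)=\int f(s)\,\beta^0_s(g(t-s))\,ds$. Put $(Zf)(t)=tf(t)$, $(\tilde Xf)(t)=X(f(t))$, $(\tilde Yf)(t)=Y(f(t))$, and let $\beta^1$ act on $\mathcal A\rtimes_{\beta^0}\mathbb R$ by the automorphisms $(\beta^1_tf)(s)=2^t\beta^1_t(f(2^ts))$. For an $n$-cochain $\varphi$ on $\mathcal A$ and $\hat\varphi(a_0\,da_1\cdots da_n)=\varphi(a_0,\dots,a_n)$ the associated functional on universal forms, $\mathrm{sh}_{\beta^0}\varphi$ is the $(n+1)$-cochain on $\mathcal A\rtimes_{\beta^0}\mathbb R$ $$\mathrm{sh}_{\beta^0}\varphi(f_0,\dots,f_{n+1})=2\pi i\sum_{j=1}^{n+1}(-1)^{n+j}\int_{t_0+\cdots+t_{n+1}=0}\int_{p_j}^{p_{j+1}}\hat\varphi\big(a_0\,da_1\cdots da_{j-1}\,a_j\,da_{j+1}\cdots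 da_{n+1}\big)\,du,$$ where $p_i=t_0+\dots+t_{i-1}$ and $a_i=\beta^0_{p_i-u}(f_i(t_i))$. **Proposition.** Let $\eta$ be a $G$-invariant probability on $X_w$ and $\tau_{w,\eta}(f,g)=\int Y(f)\,g\,d\eta$ on $\mathcal A$. For all $f,g,h\in\mathcal A\rtimes_{\beta^0}\mathbb R$, writing $\eta(F(0))=\int_{X_w}F(0)\,d\eta$: 1. $$\begin{aligned}\mathrm{sh}_{\beta^0}\tau_{w,\eta}(f,g,h)={}&-2\pi i\Big(\eta\big((\tilde Yf*g*Zh)(0)\big)-\eta\big((Zf*g*\tilde Yh)(0)\big)\Big)\\&-2\pi i\ln 2\Big(\tfrac12\eta\big((Z^2f*g*\tilde Xh)(0)\big)+\eta\big((Zf*Zg*\tilde Xh)(0)\big)-\tfrac12\eta\big((\tilde Xf*g*Z^2h)(0)\big)\Big).\end{aligned}$$ 2. $\mathrm{sh}_{\beta^0}\tau_{w,\eta}(\beta^1_tf,\beta^1_tg,\beta^1_th)=\mathrm{sh}_{\beta^0}\tau_{w,\eta}(f,g,h)$ for all $t\in\mathbb R$, i.e. $\mathrm{sh}_{\beta^0}\tau_{w,\eta}$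 is $\beta^1$-invariant. -/

import Mathlib

open MeasureTheory Filter Topology

noncomputable section

namespace PenroseHull

/-! ### The affine group acting on the hyperbolic plane -/

/-- The orientation preserving affine group: the maps `z ↦ a z + b` with `a > 0`. -/
@[ext] structure AffG where
  a : ℝ
  b : ℝ
  a_pos : 0 < a

namespace AffG

instance : Mul AffG := ⟨fun g h => ⟨g.a * h.a, g.a * h.b + g.b, mul_pos g.a_pos h.a_pos⟩⟩
instance : One AffG := ⟨⟨1, 0, one_pos⟩⟩
instance : Inv AffG := ⟨fun g => ⟨g.a⁻¹, -(g.a⁻¹ * g.b), inv_pos.2 g.a_pos⟩⟩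

@[simp] theorem mul_a (g h : AffG) : (g * h).a = g.a * h.a := rfl
@[simp] theorem mul_b (g h : AffG) : (g * h).b = g.a * h.b + g.b := rfl
@[simp] theorem one_a : (1 : AffG).a = 1 := rfl
@[simp] theorem one_b : (1 : AffG).b = 0 := rfl
@[simp] theorem inv_a (g : AffG) : (g⁻¹).a = g.a⁻¹ := rfl
@[simp] theorem inv_b (g : AffG) : (g⁻¹).b = -(g.a⁻¹ * g.b) := rfl

instance : Group AffG :=
  Group.ofLeftAxioms
    (fun g h k => by ext <;> simp <;> ring)
    (fun g => by ext <;> simp)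
    (fun g => by ext <;> simp [g.a_pos.ne'])

/-- `z ↦ a z + b` on the upper half plane. -/
instance : SMul AffG UpperHalfPlane :=
  ⟨fun g z => g.b +ᵥ ((⟨g.a, g.a_pos⟩ : {x : ℝ // 0 < x}) • z)⟩

theorem smul_def (g : AffG) (z : UpperHalfPlane) :
    g • z = g.b +ᵥ ((⟨g.a, g.a_pos⟩ : {x : ℝ // 0 < x}) • z) := rfl

@[simp] theorem coe_smul (g : AffG) (z : UpperHalfPlane) :
    ((g • z : UpperHalfPlane) : ℂ) = g.a * z + g.b := by
  rw [smul_def]; simp [add_comm]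

instance : MulAction AffG UpperHalfPlane where
  one_smul z := by apply UpperHalfPlane.ext; simp
  mul_smul g h z := by apply UpperHalfPlane.ext; simp; ring

theorem dist_smul' (g : AffG) (z w : UpperHalfPlane) : dist (g • z) (g • w) = dist z w := by
  rw [smul_def, smul_def, (UpperHalfPlane.isometry_real_vadd _).dist_eq]
  exact (UpperHalfPlane.isometry_pos_mul _).dist_eq z w

/-- The horizontal translation `z ↦ z + t`. -/
def translation (t : ℝ) : AffG := ⟨1, t, one_pos⟩

/-- The dilation `z ↦ 2 ^ t z`. -/
def dilation (t : ℝ) : AffG := ⟨(2 : ℝ) ^ t, 0, by positivity⟩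

end AffG

/-! ### The pentagon and its coloured tilings -/

/-- The origin `i` of the hyperbolic plane. -/
def origin : UpperHalfPlane := ⟨⟨0, 1⟩, one_pos⟩

/-- A set is (geodesically) convex if it contains the geodesic segment
`{p | d(z,p) + d(p,z') = d(z,z')}` between any two of its points. -/
def IsGeodesicallyConvex (K : Set UpperHalfPlane) : Prop :=
  ∀ z ∈ K, ∀ z' ∈ K, ∀ p, dist z p + dist p z' = dist z z' → p ∈ K

/-- The vertices `i`, `1/2 + i`, `1 + i`, `1 + 2i`, `2i`. -/
def vertices : Set UpperHalfPlane :=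
  {⟨⟨0, 1⟩, one_pos⟩, ⟨⟨1 / 2, 1⟩, one_pos⟩, ⟨⟨1, 1⟩, one_pos⟩,
    ⟨⟨1, 2⟩, two_pos⟩, ⟨⟨0, 2⟩, two_pos⟩}

/-- The convex hyperbolic pentagon `P`: the hyperbolic convex hull of its vertices. -/
def pentagon : Set UpperHalfPlane :=
  ⋂₀ {K | IsGeodesicallyConvex K ∧ vertices ⊆ K}

/-- A coloured tile is a subset of the plane with a colour among `r` colours. -/
abbrev Tile (r : ℕ) := Set UpperHalfPlane × Fin r

variable {r : ℕ}

/-- Collections of coloured tiles which tile the plane, with prototiles the coloured pentagons: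
every tile is the image of the pentagon under an affine map, the tiles cover the plane, and
the interiors of distinct tiles are disjoint. -/
structure IsTiling (T : Set (Tile r)) : Prop where
  prototile : ∀ t ∈ T, ∃ g : AffG, t.1 = (fun z => g • z) '' pentagon
  cover : ∀ z, ∃ t ∈ T, z ∈ t.1
  disjoint : ∀ t ∈ T, ∀ t' ∈ T, t ≠ t' → Disjoint (interior t.1) (interior t'.1)

/-- The image of a coloured tile under an affine map. -/
def moveTile (g : AffG) (t : Tile r) : Tile r := ((fun z => g • z) '' t.1, t.2)

/-- The image `g.T` of a collection of coloured tiles. -/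
def move (g : AffG) (T : Set (Tile r)) : Set (Tile r) := moveTile g '' T

/-- The coloured Penrose tiling `{R^q S^n (P_{w_{-q}}) | n, q ∈ ℤ}`, with `R z = 2 z` and
`S z = z + 1`. -/
def penroseTiling (w : ℤ → Fin r) : Set (Tile r) :=
  {t | ∃ n q : ℤ, t =
    moveTile (AffG.dilation 1 ^ q * AffG.translation 1 ^ n) (pentagon, w (-q))}

/-- The restriction `T ∩ K` of a coloured tiling: the nonempty coloured traces of its tiles. -/
def restrict (T : Set (Tile r)) (K : Set UpperHalfPlane) : Set (Tile r) :=
  {s | s.1.Nonempty ∧ ∃ t ∈ T, s = (t.1 ∩ K, t.2)}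

/-- The `ε ∈ (0, 1/√2]` such that, for some `g` in the `ε`-ball around the identity of the affine
group (identified with the hyperbolic plane by `g ↦ g • i`), `g.T` and `T'` agree on the ball of
radius `1/ε` centred at the origin. -/
def closeness (T T' : Set (Tile r)) : Set ℝ :=
  {ε | 0 < ε ∧ ε ≤ 1 / √2 ∧ ∃ g : AffG, dist (g • origin) origin < ε ∧
    restrict (move g T) (Metric.ball origin (1 / ε)) =
      restrict T' (Metric.ball origin (1 / ε))}

open Classical in
/-- The tiling distance. -/
def tilingDist (T T' : Set (Tile r)) : ℝ :=
  if (closeness T T').Nonempty then sInf (closeness T T') else 1 / √2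

/-- The points of the continuous hull of `T`: the tilings which are limits, for the tiling
distance, of tilings in the orbit of `T` under the affine group. -/
def hullSet (T : Set (Tile r)) : Set (Set (Tile r)) :=
  {T' | IsTiling T' ∧ ∀ ε > 0, ∃ g : AffG, tilingDist (move g T) T' < ε}

/-! #### The hull is stable under the affine group -/

theorem moveTile_mul (g h : AffG) (t : Tile r) :
    moveTile (g * h) t = moveTile g (moveTile h t) := by
  simp [moveTile, Set.image_image, mul_smul]

theorem moveTile_one (t : Tile r) : moveTile (1 : AffG) t = t := by
  simp [moveTile]

theorem move_mul (g h : AffG) (T : Set (Tile r)) : move (g * h) T = move g (move h T) := by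
  simp [move, Set.image_image, moveTile_mul]

theorem move_one (T : Set (Tile r)) : move (1 : AffG) T = T := by
  simp [move, moveTile_one]

theorem restrict_mono_eq {T T' : Set (Tile r)} {K L : Set UpperHalfPlane} (hKL : K ⊆ L)
    (h : restrict T L = restrict T' L) : restrict T K = restrict T' K := by
  have key : ∀ {T T' : Set (Tile r)}, restrict T L = restrict T' L →
      restrict T K ⊆ restrict T' K := by
    rintro T T' h s ⟨hs, t, ht, rfl⟩
    have h1 : (t.1 ∩ L, t.2) ∈ restrict T L :=
      ⟨hs.mono (Set.inter_subset_inter_right _ hKL), t, ht, rfl⟩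
    rw [h] at h1
    obtain ⟨-, t', ht', he⟩ := h1
    refine ⟨hs, t', ht', ?_⟩
    have e1 : t.1 ∩ L = t'.1 ∩ L := (Prod.mk.inj he).1
    have e2 : t.2 = t'.2 := (Prod.mk.inj he).2
    have e3 : ∀ u : Set UpperHalfPlane, u ∩ K = (u ∩ L) ∩ K := fun u => by
      rw [Set.inter_assoc, Set.inter_eq_right.2 hKL]
    rw [Prod.mk.injEq]
    exact ⟨by rw [e3 t.1, e1, ← e3], e2⟩
  exact Set.Subset.antisymm (key h) (key h.symm)

theorem restrict_move (g : AffG) (T : Set (Tile r)) (K : Set UpperHalfPlane) :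
    restrict (move g T) ((fun z => g • z) '' K) = move g (restrict T K) := by
  have hinj : Function.Injective (fun z : UpperHalfPlane => g • z) := MulAction.injective g
  ext s
  constructor
  · rintro ⟨hs, _, ⟨t, ht, rfl⟩, rfl⟩
    refine ⟨(t.1 ∩ K, t.2), ⟨?_, t, ht, rfl⟩, ?_⟩
    · simp only [moveTile, ← Set.image_inter hinj] at hs
      exact Set.image_nonempty.1 hs
    · simp [moveTile, Set.image_inter hinj]
  · rintro ⟨_, ⟨hs, t, ht, rfl⟩, rfl⟩
    exact ⟨hs.image _, moveTile g t, ⟨t, ht, rfl⟩, by simp [moveTile, Set.image_inter hinj]⟩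

theorem mem_hullSet_iff {T T' : Set (Tile r)} : T' ∈ hullSet T ↔
    IsTiling T' ∧ ∀ ρ : ℝ, ∃ g : AffG, restrict (move g T) (Metric.ball origin ρ) =
      restrict T' (Metric.ball origin ρ) := by
  refine and_congr_right fun _ => ⟨fun h ρ => ?_, fun h ε hε => ?_⟩
  · obtain ⟨g, hg⟩ := h (min (1 / √2) (1 / (max ρ 1))) (by positivity)
    have hne : (closeness (move g T) T').Nonempty := by
      by_contra hne
      rw [tilingDist, if_neg hne] at hg
      exact absurd (hg.trans_le (min_le_left _ _)) (lt_irrefl _)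
    rw [tilingDist, if_pos hne] at hg
    obtain ⟨ε, ⟨hε, -, k, -, hk⟩, hlt⟩ := exists_lt_of_csInf_lt hne hg
    refine ⟨k * g, restrict_mono_eq (Metric.ball_subset_ball ?_) (by rw [move_mul]; exact hk)⟩
    have h1 : ε < 1 / max ρ 1 := hlt.trans_le (min_le_right _ _)
    have h2 : (0 : ℝ) < max ρ 1 := by positivity
    rw [lt_div_iff₀ h2] at h1
    exact (le_max_left ρ 1).trans (by rw [le_div_iff₀ hε]; linarith)
  · set ε' := min (1 / √2) (ε / 2) with hε'
    have hpos : 0 < ε' := by positivity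
    obtain ⟨g, hg⟩ := h (1 / ε')
    have hmem : ε' ∈ closeness (move g T) T' :=
      ⟨hpos, min_le_left _ _, 1, by simpa using hpos, by rw [move_one]; exact hg⟩
    refine ⟨g, ?_⟩
    rw [tilingDist, if_pos ⟨_, hmem⟩]
    exact (csInf_le ⟨0, fun x hx => hx.1.le⟩ hmem).trans_lt
      ((min_le_right _ _).trans_lt (half_lt_self hε))

theorem IsTiling.move {T : Set (Tile r)} (h : IsTiling T) (g : AffG) :
    IsTiling (PenroseHull.move g T) := by
  have hiso : Isometry (fun z : UpperHalfPlane => g • z) :=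
    Isometry.of_dist_eq (AffG.dist_smul' g)
  let e : UpperHalfPlane ≃ₜ UpperHalfPlane :=
    (IsometryEquiv.mk (MulAction.toPerm g) hiso).toHomeomorph
  have hint : ∀ K : Set UpperHalfPlane,
      interior ((fun z => g • z) '' K) = (fun z => g • z) '' interior K :=
    fun K => (e.image_interior K).symm
  refine ⟨?_, fun z => ?_, ?_⟩
  · rintro _ ⟨t, ht, rfl⟩
    obtain ⟨k, hk⟩ := h.prototile t ht
    exact ⟨g * k, by simp [moveTile, hk, Set.image_image, mul_smul]⟩
  · obtain ⟨t, ht, hz⟩ := h.cover (g⁻¹ • z)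
    exact ⟨moveTile g t, ⟨t, ht, rfl⟩, g⁻¹ • z, hz, by simp⟩
  · rintro _ ⟨t, ht, rfl⟩ _ ⟨t', ht', rfl⟩ hne
    simp only [moveTile, hint]
    exact (Set.disjoint_image_iff (MulAction.injective g)).2
      (h.disjoint t ht t' ht' fun he => hne (by rw [he]))

theorem move_mem_hullSet {T T' : Set (Tile r)} (g : AffG) (h : T' ∈ hullSet T) :
    move g T' ∈ hullSet T := by
  rw [mem_hullSet_iff] at h ⊢
  refine ⟨h.1.move g, fun ρ => ?_⟩
  obtain ⟨k, hk⟩ := h.2 (ρ + dist origin (g • origin))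
  refine ⟨g * k, ?_⟩
  have hsub : Metric.ball origin ρ ⊆
      (fun z => g • z) '' Metric.ball origin (ρ + dist origin (g • origin)) := by
    intro z hz
    refine ⟨g⁻¹ • z, ?_, by simp⟩
    have h1 : dist (g⁻¹ • z) origin = dist z (g • origin) := by
      rw [← AffG.dist_smul' g, smul_inv_smul]
    rw [Metric.mem_ball] at hz ⊢
    rw [h1]
    linarith [dist_triangle z origin (g • origin)]
  refine restrict_mono_eq hsub ?_
  rw [move_mul, restrict_move, restrict_move, hk]

/-! ### The continuous hull as a dynamical system -/

/-- The continuous hull of the coloured Penrose tiling associated to the sequence `w`. -/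
def Hull (w : ℤ → Fin r) : Type := {T : Set (Tile r) // T ∈ hullSet (penroseTiling w)}

variable {w : ℤ → Fin r}

/-- The action of the affine group on the hull. -/
instance : MulAction AffG (Hull w) where
  smul g T := ⟨move g T.1, move_mem_hullSet g T.2⟩
  one_smul T := Subtype.ext (move_one T.1)
  mul_smul g h T := Subtype.ext (move_mul g h T.1)

/-- The topology of the tiling distance. -/
instance : TopologicalSpace (Hull w) where
  IsOpen U := ∀ T ∈ U, ∃ ρ > 0, ∀ T' : Hull w, tilingDist T.1 T'.1 < ρ → T' ∈ U
  isOpen_univ := fun _ _ => ⟨1, one_pos, fun _ _ => trivial⟩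
  isOpen_inter := by
    rintro U V hU hV T ⟨hTU, hTV⟩
    obtain ⟨a, ha, hA⟩ := hU T hTU
    obtain ⟨b, hb, hB⟩ := hV T hTV
    exact ⟨min a b, lt_min ha hb, fun T' hT' =>
      ⟨hA T' (hT'.trans_le (min_le_left _ _)), hB T' (hT'.trans_le (min_le_right _ _))⟩⟩
  isOpen_sUnion := by
    rintro S hS T ⟨U, hU, hTU⟩
    obtain ⟨a, ha, hA⟩ := hS U hU T hTU
    exact ⟨a, ha, fun T' hT' => ⟨U, hU, hA T' hT'⟩⟩

instance : MeasurableSpace (Hull w) := borel (Hull w)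

instance : BorelSpace (Hull w) := ⟨rfl⟩

/-- The action on functions induced by the flow `(t, T) ↦ T + t`. -/
def beta0 (t : ℝ) (f : Hull w → ℂ) : Hull w → ℂ := fun T => f (AffG.translation t • T)

/-- The action on functions induced by the flow `(t, T) ↦ R_{2^t} T`. -/
def beta1 (t : ℝ) (f : Hull w → ℂ) : Hull w → ℂ := fun T => f (AffG.dilation t • T)

/-- The vector field (along the leaves) of the action `beta0`. -/
def fieldX (f : Hull w → ℂ) : Hull w → ℂ := fun T => deriv (fun t => beta0 t f T) 0

/-- The vector field (along the leaves) of the action `beta1`. -/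
def fieldY (f : Hull w → ℂ) : Hull w → ℂ := fun T => deriv (fun t => beta1 t f T) 0

/-! ### Functions which are smooth along the leaves, and the smooth crossed product -/

/-- Membership in the algebra of continuous functions on the hull which are smooth along the
leaves: the function is smooth on every leaf (in the coordinates `(s, b) ↦ R_{2^s} T + b`), and its
derivatives of all orders along the leaves are continuous on the hull. They are then bounded, the
hull being compact. -/
structure IsLeafSmooth (f : Hull w → ℂ) : Prop where
  smooth : ∀ T : Hull w, ContDiff ℝ (⊤ : ℕ∞) (fun p : ℝ × ℝ =>
    f ((AffG.translation p.2 * AffG.dilation p.1) • T))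
  continuous : ∀ k l : ℕ, Continuous (fieldX^[k] (fieldY^[l] f))
  bounded : ∀ k l : ℕ, ∃ C : ℝ, ∀ T, ‖fieldX^[k] (fieldY^[l] f) T‖ ≤ C

/-- The semi-norms `sup |X^k Y^l f|` of the Fréchet algebra of functions smooth along the leaves. -/
def leafNorm (k l : ℕ) (f : Hull w → ℂ) : ℝ := ⨆ T, ‖fieldX^[k] (fieldY^[l] f) T‖

/-- The curve `f` has derivative `f'` at `t` in the Fréchet topology given by the semi-norms. -/
def HasFrechetDerivAt (f : ℝ → Hull w → ℂ) (f' : Hull w → ℂ) (t : ℝ) : Prop :=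
  ∀ k l : ℕ, Tendsto (fun h : ℝ => leafNorm k l ((h : ℂ)⁻¹ • (f (t + h) - f t) - f'))
    (𝓝[≠] 0) (𝓝 0)

/-- Membership in the smooth crossed product by `beta0`: smooth curves `f` in the Fréchet algebra
of functions smooth along the leaves (with successive derivatives `F m`) such that
`sup_t (1+t²)^{k/2} ‖f^{(m)}(t)‖ < ∞` for every `k`, `m` and every semi-norm. -/
def MemSmoothCrossedProduct (f : ℝ → Hull w → ℂ) : Prop :=
  ∃ F : ℕ → ℝ → Hull w → ℂ, F 0 = f ∧ (∀ m t, IsLeafSmooth (F m t)) ∧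
    (∀ m t, HasFrechetDerivAt (F m) (F (m + 1) t) t) ∧
    ∀ k m p q : ℕ, ∃ C : ℝ, ∀ t : ℝ,
      (1 + t ^ 2) ^ ((k : ℝ) / 2) * leafNorm p q (F m t) ≤ C

/-- The convolution product `(f * g)(t) = ∫ f(s) β⁰_s(g(t - s)) ds`. -/
def conv (f g : ℝ → Hull w → ℂ) : ℝ → Hull w → ℂ :=
  fun t T => ∫ s : ℝ, f s T * beta0 s (g (t - s)) T

/-- The derivation `Z f (t) = t f(t)`. -/
def derivZ (f : ℝ → Hull w → ℂ) : ℝ → Hull w → ℂ := fun t => (t : ℂ) • f t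

/-- The operator `f ↦ (t ↦ X (f t))`. -/
def tildeX (f : ℝ → Hull w → ℂ) : ℝ → Hull w → ℂ := fun t => fieldX (f t)

/-- The operator `f ↦ (t ↦ Y (f t))`. -/
def tildeY (f : ℝ → Hull w → ℂ) : ℝ → Hull w → ℂ := fun t => fieldY (f t)

/-- The action by automorphisms of `beta1` on the crossed product by `beta0`. -/
def beta1Crossed (t : ℝ) (f : ℝ → Hull w → ℂ) : ℝ → Hull w → ℂ :=
  fun s => (((2 : ℝ) ^ t : ℝ) : ℂ) • beta1 t (f ((2 : ℝ) ^ t * s))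

/-- `η(F(0))`, for `F` in the crossed product. -/
def evalZero (η : Measure (Hull w)) (F : ℝ → Hull w → ℂ) : ℂ := ∫ T, F 0 T ∂η

/-! ### The Elliott–Natsume–Nest map on cochains -/

/-- With `φ̂(a₀ da₁ ⋯ daₙ) = φ(a₀, …, aₙ)` on the universal differential forms, this is
`φ̂(a₀ da₁ ⋯ da_{j-1} a_j da_{j+1} ⋯ da_{n+1})` (for `1 ≤ j`), expanded by the Leibniz rule. -/
def formInsert {B : Type*} [Mul B] {n : ℕ} (φ : (Fin (n + 1) → B) → ℂ) (j : Fin (n + 2))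
    (a : Fin (n + 2) → B) : ℂ :=
  ∑ k : Fin (n + 2) with k < j,
    (-1) ^ (j.val - 1 - k.val) * φ (k.contractNth (· * ·) a)

/-- `t₀ + ⋯ + t_{i-1}`. -/
def partialSum {m : ℕ} (t : Fin m → ℝ) (i : ℕ) : ℝ := ∑ k : Fin m with k.val < i, t k

/-- The map `sh_α` from `n`-cochains on an algebra with an action `α` of `ℝ` to
`(n+1)`-cochains on the crossed product. With `p_i = t₀ + ⋯ + t_{i-1}`,
`sh_α φ (f₀, …, f_{n+1})` is the sum over `1 ≤ j ≤ n + 1` of `2πi (-1)^{n+j}` times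
`∫_{t₀+⋯+t_{n+1}=0} ∫_{p_j}^{p_{j+1}} φ̂(α_{-u}(f₀(t₀) dα_{p₁}f₁(t₁) ⋯ α_{p_j}f_j(t_j) ⋯
dα_{p_{n+1}}f_{n+1}(t_{n+1}))) du`, where there is no `d` in front of the `j`-th factor. -/
def sh {B : Type*} [Mul B] (α : ℝ → B → B) {n : ℕ} (φ : (Fin (n + 1) → B) → ℂ)
    (f : Fin (n + 2) → ℝ → B) : ℂ :=
  2 * Real.pi * Complex.I * ∑ j : Fin (n + 1), (-1) ^ (n + (j.val + 1)) *
    ∫ t' : Fin (n + 1) → ℝ,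
      let t : Fin (n + 2) → ℝ := Fin.cons (-∑ i, t' i) t'
      ∫ u in (partialSum t (j.val + 1))..(partialSum t (j.val + 2)),
        formInsert φ j.succ (fun i => α (partialSum t i.val - u) (f i (t i)))

/-- The cyclic `1`-cocycle `τ_{w,η}(f, g) = ∫ Y(f) g dη`. -/
def tau (η : Measure (Hull w)) (v : Fin 2 → Hull w → ℂ) : ℂ :=
  ∫ T, fieldY (v 0) T * v 1 T ∂η

end PenroseHull

end

noncomputable section

namespace PenroseHull

variable {r : ℕ} {w : ℤ → Fin r}

/-! Both parts rest on the relation `dilation s * translation t = translation (2 ^ s * t) * dilation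
s`.

For the formula, work at a fixed point of the plane `t₀ + t₁ + t₂ = 0`, parametrised by the last two
coordinates. Invariance of `η` under translations removes the common shift by `u`, except that `Y`
does not commute with `beta0`: differentiating the relation gives `Y β⁰_s = β⁰_s Y - s ln 2 β⁰_s X`.
So τ of the shifted functions is affine in `u`, with coefficients of the form `triple`
(`tau_translate_left`, `tau_translate_right`). When the product of the first two functions stands
under `Y`, the derivative is moved to the third by `∫ Y(a) dη = 0` (`HasBoundedY.integral_fieldY`).
The `u`-integral then yields polynomials of degree at most two in the times, and multiplication by a
time is what `derivZ` does. The formula is thus a polynomial identity at each point of the plane,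
integrated over the plane. Fubini (`evalZero_conv_conv`) identifies the integrals of `triple` with
the values `η((F * G * H)(0))`; the decay and joint measurability it needs come from
`MemSmoothCrossedProduct.isRapid`.

For the invariance, τ is `beta1`-invariant because dilations commute with one another and preserve
`η`. Scaling the three integration variables by `2 ^ t` absorbs the three factors `2 ^ t` of
`beta1Crossed`. -/

/-! ### Relations between translations and dilations -/

theorem AffG.translation_mul (s t : ℝ) :
    AffG.translation s * AffG.translation t = AffG.translation (s + t) := by
  ext <;> simp [AffG.translation, add_comm]

theorem AffG.dilation_mul (s t : ℝ) :
    AffG.dilation s * AffG.dilation t = AffG.dilation (s + t) := by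
  ext <;> simp [AffG.dilation, Real.rpow_add]

theorem AffG.dilation_mul_translation (s t : ℝ) :
    AffG.dilation s * AffG.translation t =
      AffG.translation ((2 : ℝ) ^ s * t) * AffG.dilation s := by
  ext <;> simp [AffG.dilation, AffG.translation]

theorem AffG.translation_zero : AffG.translation 0 = 1 := rfl

theorem AffG.dilation_zero : AffG.dilation 0 = 1 := by
  ext <;> simp [AffG.dilation]

/-! ### The Elliott–Natsume–Nest map on `1`-cochains -/

theorem formInsert_one {B : Type*} [Mul B] (φ : (Fin 2 → B) → ℂ) (a : Fin 3 → B) :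
    formInsert φ 1 a = φ ![a 0 * a 1, a 2] := by
  have h : (Finset.univ.filter fun k : Fin 3 => k < 1) = {0} := by decide
  unfold formInsert
  rw [h, Finset.sum_singleton]
  simp only [Fin.val_one, Fin.val_zero]
  norm_num
  congr 1
  funext i
  fin_cases i <;> rfl

/-- Leibniz rule: `(da₁) a₂ = d(a₁ a₂) - a₁ da₂`. -/
theorem formInsert_two {B : Type*} [Mul B] (φ : (Fin 2 → B) → ℂ) (a : Fin 3 → B) :
    formInsert φ 2 a = φ ![a 0, a 1 * a 2] - φ ![a 0 * a 1, a 2] := by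
  have h : (Finset.univ.filter fun k : Fin 3 => k < 2) = {0, 1} := by decide
  have h0 : (0 : Fin 3).contractNth (· * ·) a = ![a 0 * a 1, a 2] := by
    funext i
    fin_cases i <;> rfl
  have h1 : (1 : Fin 3).contractNth (· * ·) a = ![a 0, a 1 * a 2] := by
    funext i
    fin_cases i <;> rfl
  unfold formInsert
  rw [h, Finset.sum_pair (by decide), h0, h1]
  simp only [Fin.val_one, Fin.val_zero, Fin.val_two]
  norm_num
  ring

/-- Here `t 0` and `t 1` are the times of `g` and `h`, so the time of `f` is `-(t 0 + t 1)`, and `p₁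
= -(t 0 + t 1)`, `p₂ = -t 1`, `p₃ = 0`. The sign is `+` for `j = 1` and `-` for `j = 2`. -/
theorem sh_one_cochain {B : Type*} [Mul B] (α : ℝ → B → B) (φ : (Fin 2 → B) → ℂ)
    (f g h : ℝ → B) :
    sh α φ ![f, g, h] = 2 * Real.pi * Complex.I *
      ((∫ t : Fin 2 → ℝ, ∫ u in (-(t 0 + t 1))..(-t 1),
          φ ![α (-u) (f (-(t 0 + t 1))) * α (-(t 0 + t 1) - u) (g (t 0)),
            α (-t 1 - u) (h (t 1))])
        - ∫ t : Fin 2 → ℝ, ∫ u in (-t 1)..0,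
          (φ ![α (-u) (f (-(t 0 + t 1))),
              α (-(t 0 + t 1) - u) (g (t 0)) * α (-t 1 - u) (h (t 1))]
            - φ ![α (-u) (f (-(t 0 + t 1))) * α (-(t 0 + t 1) - u) (g (t 0)),
              α (-t 1 - u) (h (t 1))])) := by
  have e1 : ((0 : Fin 2).succ) = (1 : Fin 3) := rfl
  have e2 : ((1 : Fin 2).succ) = (2 : Fin 3) := rfl
  have p0 : ∀ t : Fin 3 → ℝ, partialSum t 0 = 0 := fun t => by simp [partialSum]
  have p1 : ∀ t : Fin 3 → ℝ, partialSum t 1 = t 0 := fun t => by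
    simp [partialSum, Finset.sum_filter]
  have p2 : ∀ t : Fin 3 → ℝ, partialSum t 2 = t 0 + t 1 := fun t => by
    simp [partialSum, Finset.sum_filter, Fin.sum_univ_succ]
  have p3 : ∀ t : Fin 3 → ℝ, partialSum t 3 = t 0 + t 1 + t 2 := fun t => by
    simp [partialSum, Fin.sum_univ_succ, add_assoc]
  have s1 : ∀ t : Fin 2 → ℝ, -(t 0 + t 1) + t 0 = -t 1 := fun t => by ring
  have c1 : ∀ (x : ℝ) (t : Fin 2 → ℝ), (Fin.cons x t : Fin 3 → ℝ) 1 = t 0 := fun x t => rfl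
  have c2 : ∀ (x : ℝ) (t : Fin 2 → ℝ), (Fin.cons x t : Fin 3 → ℝ) 2 = t 1 := fun x t => rfl
  unfold sh
  simp only [Fin.sum_univ_two, e1, e2, formInsert_one, formInsert_two, Fin.val_zero, Fin.val_one,
    Fin.val_two, zero_add, Nat.reduceAdd, p0, p1, p2, p3, Fin.cons_zero, c1, c2, s1, zero_sub,
    neg_add_cancel, Matrix.cons_val_zero, Matrix.cons_val_one, Matrix.cons_val]
  ring

/-! ### Invariance -/

theorem beta0_beta1 (s t : ℝ) (f : Hull w → ℂ) :
    beta0 s (beta1 t f) = beta1 t (beta0 ((2 : ℝ) ^ t * s) f) := by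
  funext T
  simp only [beta0, beta1, ← mul_smul, AffG.dilation_mul_translation]

theorem fieldY_beta1 (t : ℝ) (f : Hull w → ℂ) : fieldY (beta1 t f) = beta1 t (fieldY f) := by
  funext T
  simp only [fieldY, beta1, ← mul_smul, AffG.dilation_mul, add_comm]

theorem fieldY_const_smul (c : ℂ) (f : Hull w → ℂ) : fieldY (c • f) = c • fieldY f := by
  funext T
  exact deriv_const_mul_field c

/-- Since `g⁻¹` also acts measurably, `g` acts by a measurable equivalence, and no regularity of `k`
is needed. Hence the invariance statement holds for arbitrary curves. -/
theorem integral_comp_action {η : Measure (Hull w)}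
    (hη : ∀ g : AffG, MeasurePreserving (fun T : Hull w => g • T) η η) (g : AffG)
    (k : Hull w → ℂ) : ∫ T, k (g • T) ∂η = ∫ T, k T ∂η := by
  let e : Hull w ≃ᵐ Hull w :=
    { toEquiv := MulAction.toPerm g
      measurable_toFun := (hη g).measurable
      measurable_invFun := (hη g⁻¹).measurable }
  exact MeasurePreserving.integral_comp' (f := e) (hη g) k

theorem tau_pair (η : Measure (Hull w)) (a b : Hull w → ℂ) :
    tau η ![a, b] = ∫ T, fieldY a T * b T ∂η := rfl

theorem tau_smul_beta1 {η : Measure (Hull w)}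
    (hη : ∀ g : AffG, MeasurePreserving (fun T : Hull w => g • T) η η) (t : ℝ) (c d : ℂ)
    (a b : Hull w → ℂ) : tau η ![c • beta1 t a, d • beta1 t b] = c * d * tau η ![a, b] := by
  rw [tau_pair, tau_pair, fieldY_const_smul, fieldY_beta1, ← integral_const_mul,
    ← integral_comp_action hη (AffG.dilation t) fun T => c * d * (fieldY a T * b T)]
  congr 1
  funext T
  simp only [Pi.smul_apply, smul_eq_mul, beta1]
  ring

theorem sh_tau_beta1Crossed {η : Measure (Hull w)}
    (hη : ∀ g : AffG, MeasurePreserving (fun T : Hull w => g • T) η η) (t : ℝ)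
    (f g h : ℝ → Hull w → ℂ) :
    sh beta0 (tau η) ![beta1Crossed t f, beta1Crossed t g, beta1Crossed t h] =
      sh beta0 (tau η) ![f, g, h] := by
  have hc : 0 < (2 : ℝ) ^ t := by positivity
  have hb : ∀ (s : ℝ) (f : ℝ → Hull w → ℂ) (x : ℝ), beta0 s (beta1Crossed t f x) =
      (((2 : ℝ) ^ t : ℝ) : ℂ) • beta1 t (beta0 ((2 : ℝ) ^ t * s) (f ((2 : ℝ) ^ t * x))) := by
    intro s f x
    rw [← beta0_beta1]
    rfl
  have hmul : ∀ (c : ℂ) (a b : Hull w → ℂ),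
      (c • beta1 t a) * (c • beta1 t b) = (c * c) • beta1 t (a * b) := by
    intro c a b
    funext T
    simp only [Pi.smul_apply, Pi.mul_apply, smul_eq_mul, beta1]
    ring
  set c := (2 : ℝ) ^ t
  have hcc : (c : ℂ) ≠ 0 := by exact_mod_cast hc.ne'
  -- Scaling `u` costs one factor `c⁻¹` and scaling the plane costs `c⁻²`; the bounds `p`, `q` are
  -- homogeneous, so they scale along. Both substitutions are valid without integrability.
  have key : ∀ (p q : (Fin 2 → ℝ) → ℝ) (E : (Fin 2 → ℝ) → ℝ → ℂ), (∀ x, p (c • x) = c * p x) →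
      (∀ x, q (c • x) = c * q x) →
      ∫ x : Fin 2 → ℝ, ∫ u in p x..q x, (c : ℂ) * c * c * E (c • x) (c * u) =
        ∫ x : Fin 2 → ℝ, ∫ u in p x..q x, E x u := by
    intro p q E hp hq
    simp only [intervalIntegral.integral_const_mul, integral_const_mul,
      fun x => intervalIntegral.integral_comp_mul_left (a := p x) (b := q x) (E (c • x)) hc.ne',
      ← hp, ← hq]
    rw [Measure.integral_comp_smul volume (fun x => c⁻¹ • ∫ u in p x..q x, E x u) c,
      integral_smul, Module.finrank_fin_fun, abs_of_pos (by positivity), Complex.real_smul,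
      Complex.real_smul]
    push_cast
    field_simp
  rw [sh_one_cochain, sh_one_cochain]
  congr 2
  · refine Eq.trans ?_ (key _ _ _ (fun x => ?_) (fun x => ?_))
    · congr 1
      funext x
      congr 1
      funext u
      rw [hb, hb, hb, hmul, tau_smul_beta1 hη]
      simp only [Pi.smul_apply, smul_eq_mul, mul_sub, mul_add, mul_neg]
    all_goals simp only [Pi.smul_apply, smul_eq_mul]; ring
  · refine Eq.trans ?_ (key _ _ _ (fun x => ?_) (fun x => ?_))
    · congr 1
      funext x
      congr 1
      funext u
      rw [hb, hb, hb, hmul, hmul, tau_smul_beta1 hη, tau_smul_beta1 hη, ← mul_assoc, ← mul_sub]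
      simp only [Pi.smul_apply, smul_eq_mul, mul_sub, mul_add, mul_neg]
    · simp only [Pi.smul_apply, smul_eq_mul]; ring
    · exact (mul_zero c).symm

/-! ### Iterated convolutions -/

/-- Curves of measurable functions on the hull which are jointly continuous in the parameter and
along the orbits of `beta0`, and decay rapidly. -/
structure IsRapid (F : ℝ → Hull w → ℂ) : Prop where
  continuous : ∀ T, Continuous fun p : ℝ × ℝ => F p.1 (AffG.translation p.2 • T)
  measurable : ∀ t, Measurable (F t)
  decay : ∀ k : ℕ, ∃ C, ∀ t T, (1 + t ^ 2) ^ k * ‖F t T‖ ≤ C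

theorem IsRapid.derivZ {F : ℝ → Hull w → ℂ} (hF : IsRapid F) : IsRapid (derivZ F) where
  continuous T := (Complex.continuous_ofReal.comp continuous_fst).mul (hF.continuous T)
  measurable t := (hF.measurable t).const_smul (t : ℂ)
  decay k := by
    obtain ⟨C, hC⟩ := hF.decay (k + 1)
    refine ⟨C, fun t T => le_trans ?_ (hC t T)⟩
    have h1 : |t| ≤ 1 + t ^ 2 := by
      rw [← sq_abs]
      nlinarith [sq_nonneg (|t| - 1), abs_nonneg t]
    have h2 : ‖PenroseHull.derivZ F t T‖ = |t| * ‖F t T‖ := by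
      simp [PenroseHull.derivZ]
    rw [h2, pow_succ _ k, mul_assoc]
    gcongr

/-- Carathéodory's argument: continuity in the two real parameters and measurability in `T` give
joint measurability. Only measurability of each map `T ↦ g • T` is used, not continuity of the
action. -/
theorem IsRapid.measurable_uncurry (hm : ∀ g : AffG, Measurable fun T : Hull w => g • T)
    {F : ℝ → Hull w → ℂ} (hF : IsRapid F) :
    Measurable fun p : (ℝ × ℝ) × Hull w => F p.1.1 (AffG.translation p.1.2 • p.2) :=
  measurable_uncurry_of_continuous_of_measurable
    (u := fun (p : ℝ × ℝ) (T : Hull w) => F p.1 (AffG.translation p.2 • T)) hF.continuous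
    fun p => (hF.measurable p.1).comp (hm _)

theorem IsRapid.exists_bound {F : ℝ → Hull w → ℂ} (hF : IsRapid F) :
    ∃ C, 0 ≤ C ∧ ∀ t T, ‖F t T‖ ≤ C * (1 + t ^ 2)⁻¹ := by
  obtain ⟨C, hC⟩ := hF.decay 1
  refine ⟨max C 0, le_max_right _ _, fun t T => ?_⟩
  rw [← div_eq_mul_inv, le_div_iff₀ (by positivity), mul_comm]
  have := hC t T
  rw [pow_one] at this
  exact this.trans (le_max_left _ _)

/-- The integrand of `η((F * G * H)(0))`, with `p = (s, r)` the convolution variables. -/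
def tripleIntegrand (F G H : ℝ → Hull w → ℂ) (T : Hull w) (p : ℝ × ℝ) : ℂ :=
  F p.2 T * G (p.1 - p.2) (AffG.translation p.2 • T) * H (-p.1) (AffG.translation p.1 • T)

/-- The function on `{t₀ + t₁ + t₂ = 0}`, in the coordinates `(t₁, t₂)`, whose integral is
`η((F * G * H)(0))`. -/
def triple (η : Measure (Hull w)) (F G H : ℝ → Hull w → ℂ) (t : Fin 2 → ℝ) : ℂ :=
  ∫ T, F (-(t 0 + t 1)) T * G (t 0) (AffG.translation (-(t 0 + t 1)) • T) *
    H (t 1) (AffG.translation (-t 1) • T) ∂η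

/-- The change of variables between `tripleIntegrand` and `triple`. -/
def tripleEquiv : (Fin 2 → ℝ) ≃ᵐ ℝ × ℝ :=
  ((MeasurableEquiv.finTwoArrow.trans MeasurableEquiv.prodComm).trans
    (MeasurableEquiv.shearAddRight ℝ)).trans (MeasurableEquiv.neg (ℝ × ℝ))

theorem tripleEquiv_apply (t : Fin 2 → ℝ) : tripleEquiv t = (-t 1, -(t 0 + t 1)) := by
  rw [add_comm]
  rfl

theorem measurePreserving_tripleEquiv : MeasurePreserving tripleEquiv volume volume :=
  (Measure.measurePreserving_neg (volume : Measure (ℝ × ℝ))).comp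
    ((measurePreserving_prod_add volume volume).comp
      (Measure.measurePreserving_swap.comp (volume_preserving_finTwoArrow ℝ)))

theorem triple_eq (η : Measure (Hull w)) (F G H : ℝ → Hull w → ℂ) (t : Fin 2 → ℝ) :
    triple η F G H t = ∫ T, tripleIntegrand F G H T (tripleEquiv t) ∂η := by
  rw [tripleEquiv_apply]
  unfold triple tripleIntegrand
  have h1 : -t 1 - -(t 0 + t 1) = t 0 := by ring
  simp only [h1, neg_neg]

section

variable {F G H : ℝ → Hull w → ℂ}

theorem measurable_tripleIntegrand (hm : ∀ g : AffG, Measurable fun T : Hull w => g • T)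
    (hF : IsRapid F) (hG : IsRapid G) (hH : IsRapid H) :
    Measurable fun q : Hull w × (ℝ × ℝ) => tripleIntegrand F G H q.1 q.2 := by
  have hF' : Measurable fun q : Hull w × (ℝ × ℝ) => F q.2.2 q.1 := by
    have := (hF.measurable_uncurry hm).comp
      (show Measurable fun q : Hull w × (ℝ × ℝ) => ((q.2.2, (0 : ℝ)), q.1) by fun_prop)
    simpa [Function.comp_def, AffG.translation_zero] using this
  exact (hF'.mul ((hG.measurable_uncurry hm).comp
    (show Measurable fun q : Hull w × (ℝ × ℝ) => ((q.2.1 - q.2.2, q.2.2), q.1) by fun_prop))).mul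
    ((hH.measurable_uncurry hm).comp
      (show Measurable fun q : Hull w × (ℝ × ℝ) => ((-q.2.1, q.2.1), q.1) by fun_prop))

/-- The outer factors are evaluated at the times `p.2` and `-p.1`, so their decay controls both
variables; boundedness of `G` suffices. -/
theorem exists_bound_tripleIntegrand (hF : IsRapid F) (hG : IsRapid G) (hH : IsRapid H) :
    ∃ C : ℝ, ∀ T p,
      ‖tripleIntegrand F G H T p‖ ≤ C * ((1 + p.1 ^ 2)⁻¹ * (1 + p.2 ^ 2)⁻¹) := by
  obtain ⟨A, hA, hA'⟩ := hF.exists_bound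
  obtain ⟨B, hB, hB'⟩ := hG.exists_bound
  obtain ⟨C, hC, hC'⟩ := hH.exists_bound
  have hB'' : ∀ t T, ‖G t T‖ ≤ B := fun t T => (hB' t T).trans
    (mul_le_of_le_one_right hB (inv_le_one_of_one_le₀ (by nlinarith [sq_nonneg t])))
  refine ⟨A * B * C, fun T p => ?_⟩
  have h3 := hC' (-p.1) (AffG.translation p.1 • T)
  rw [neg_sq] at h3
  rw [tripleIntegrand, norm_mul, norm_mul]
  calc _ ≤ A * (1 + p.2 ^ 2)⁻¹ * B * (C * (1 + p.1 ^ 2)⁻¹) := by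
        gcongr
        exacts [hA' _ _, hB'' _ _]
    _ = _ := by ring

theorem integrable_inv_mul_inv :
    Integrable (fun p : ℝ × ℝ => (1 + p.1 ^ 2)⁻¹ * (1 + p.2 ^ 2)⁻¹) :=
  integrable_inv_one_add_sq.mul_prod integrable_inv_one_add_sq

theorem integrable_tripleIntegrand (hm : ∀ g : AffG, Measurable fun T : Hull w => g • T)
    (hF : IsRapid F) (hG : IsRapid G) (hH : IsRapid H) (T : Hull w) :
    Integrable (tripleIntegrand F G H T) := by
  obtain ⟨C, hC⟩ := exists_bound_tripleIntegrand hF hG hH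
  exact (integrable_inv_mul_inv.const_mul C).mono'
    ((measurable_tripleIntegrand hm hF hG hH).comp measurable_prodMk_left).aestronglyMeasurable
    (Eventually.of_forall fun p => hC T p)

variable {η : Measure (Hull w)} [IsProbabilityMeasure η]

theorem integrable_tripleIntegrand_prod (hm : ∀ g : AffG, Measurable fun T : Hull w => g • T)
    (hF : IsRapid F) (hG : IsRapid G) (hH : IsRapid H) :
    Integrable (Function.uncurry (tripleIntegrand F G H)) (η.prod volume) := by
  obtain ⟨C, hC⟩ := exists_bound_tripleIntegrand hF hG hH
  have hb := (integrable_const (1 : ℝ) (μ := η)).mul_prod (integrable_inv_mul_inv.const_mul C)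
  refine hb.mono' (measurable_tripleIntegrand hm hF hG hH).aestronglyMeasurable
    (Eventually.of_forall fun q => ?_)
  rw [one_mul]
  exact hC q.1 q.2

theorem integrable_triple (hm : ∀ g : AffG, Measurable fun T : Hull w => g • T)
    (hF : IsRapid F) (hG : IsRapid G) (hH : IsRapid H) : Integrable (triple η F G H) := by
  rw [funext (triple_eq η F G H)]
  exact measurePreserving_tripleEquiv.integrable_comp_of_integrable
    (integrable_tripleIntegrand_prod hm hF hG hH).integral_prod_right

theorem evalZero_conv_conv (hm : ∀ g : AffG, Measurable fun T : Hull w => g • T)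
    (hF : IsRapid F) (hG : IsRapid G) (hH : IsRapid H) :
    evalZero η (conv (conv F G) H) = ∫ t, triple η F G H t := by
  simp only [triple_eq]
  rw [measurePreserving_tripleEquiv.integral_comp' fun p => ∫ T, tripleIntegrand F G H T p ∂η,
    ← integral_integral_swap (integrable_tripleIntegrand_prod hm hF hG hH)]
  unfold evalZero
  congr 1
  funext T
  rw [Measure.volume_eq_prod, integral_prod _ (integrable_tripleIntegrand hm hF hG hH T)]
  simp only [conv, ← integral_mul_const, zero_sub]
  rfl

end

/-! ### Derivatives along the leaves -/

section

variable {f : Hull w → ℂ}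

theorem IsLeafSmooth.hasFDerivAt (hf : IsLeafSmooth f) (T : Hull w) (p : ℝ × ℝ) :
    HasFDerivAt (fun p : ℝ × ℝ => f ((AffG.translation p.2 * AffG.dilation p.1) • T))
      (fderiv ℝ (fun p : ℝ × ℝ => f ((AffG.translation p.2 * AffG.dilation p.1) • T)) p) p :=
  ((hf.smooth T).differentiable (by simp) p).hasFDerivAt

theorem IsLeafSmooth.hasDerivAt_beta0 (hf : IsLeafSmooth f) (T : Hull w) (s : ℝ) :
    HasDerivAt (fun t => f (AffG.translation t • T))
      (fderiv ℝ (fun p : ℝ × ℝ => f ((AffG.translation p.2 * AffG.dilation p.1) • T)) (0, s)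
        (0, 1)) s := by
  have := (hf.hasFDerivAt T (0, s)).comp_hasDerivAt s
    ((hasDerivAt_const s (0 : ℝ)).prodMk (hasDerivAt_id s))
  simpa [Function.comp_def, AffG.dilation_zero] using this

theorem IsLeafSmooth.fieldX_translation (hf : IsLeafSmooth f) (T : Hull w) (s : ℝ) :
    fieldX f (AffG.translation s • T) =
      fderiv ℝ (fun p : ℝ × ℝ => f ((AffG.translation p.2 * AffG.dilation p.1) • T)) (0, s)
        (0, 1) := by
  have h := hf.hasDerivAt_beta0 T s
  rw [← zero_add s] at h
  have h' := (h.comp_add_const (x := 0) (a := s)).deriv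
  rw [zero_add] at h'
  rw [← h']
  simp only [fieldX, beta0, ← mul_smul, AffG.translation_mul]

/-- In the leaf chart the orbit is the curve `t ↦ (t, 2 ^ t * s)`, with velocity `(1, s ln 2)` at `t
= 0`. -/
theorem IsLeafSmooth.hasDerivAt_beta1_translation (hf : IsLeafSmooth f) (T : Hull w) (s : ℝ) :
    HasDerivAt (fun t => f (AffG.dilation t • AffG.translation s • T))
      (fderiv ℝ (fun p : ℝ × ℝ => f ((AffG.translation p.2 * AffG.dilation p.1) • T)) (0, s)
        (1, Real.log 2 * s)) 0 := by
  have hr : HasDerivAt (fun t : ℝ => (2 : ℝ) ^ t * s) (Real.log 2 * s) 0 := by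
    have := ((hasDerivAt_id (0 : ℝ)).const_rpow (a := 2) (by norm_num)).mul_const s
    simpa using this
  have h0 : ((id (0 : ℝ), (2 : ℝ) ^ (0 : ℝ) * s) : ℝ × ℝ) = (0, s) := by simp
  have := (h0.symm ▸ hf.hasFDerivAt T (0, s)).comp_hasDerivAt (0 : ℝ)
    ((hasDerivAt_id (0 : ℝ)).prodMk hr)
  simpa [Function.comp_def, ← mul_smul, AffG.dilation_mul_translation] using this

theorem IsLeafSmooth.fieldY_translation (hf : IsLeafSmooth f) (T : Hull w) (s : ℝ) :
    fieldY f (AffG.translation s • T) =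
      fderiv ℝ (fun p : ℝ × ℝ => f ((AffG.translation p.2 * AffG.dilation p.1) • T)) (0, s)
        (1, Real.log 2 * s) :=
  (hf.hasDerivAt_beta1_translation T s).deriv

theorem IsLeafSmooth.continuous_fieldX_translation (hf : IsLeafSmooth f) (T : Hull w) :
    Continuous fun s => fieldX f (AffG.translation s • T) := by
  simp only [hf.fieldX_translation]
  exact (((hf.smooth T).continuous_fderiv (by simp)).comp (by fun_prop)).clm_apply
    continuous_const

theorem IsLeafSmooth.continuous_fieldY_translation (hf : IsLeafSmooth f) (T : Hull w) :
    Continuous fun s => fieldY f (AffG.translation s • T) := by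
  simp only [hf.fieldY_translation]
  exact (((hf.smooth T).continuous_fderiv (by simp)).comp (by fun_prop)).clm_apply (by fun_prop)

theorem IsLeafSmooth.continuous_translation (hf : IsLeafSmooth f) (T : Hull w) :
    Continuous fun s => f (AffG.translation s • T) :=
  continuous_iff_continuousAt.2 fun s => (hf.hasDerivAt_beta0 T s).continuousAt

/-- `Y β⁰_s = β⁰_s Y - s ln 2 β⁰_s X`. -/
theorem IsLeafSmooth.hasDerivAt_beta1_beta0 (hf : IsLeafSmooth f) (s : ℝ) (T : Hull w) :
    HasDerivAt (fun t => beta1 t (beta0 s f) T)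
      (beta0 s (fieldY f) T - s * Real.log 2 * beta0 s (fieldX f) T) 0 := by
  have := (hf.hasFDerivAt T (0, s)).comp_hasDerivAt (0 : ℝ)
    ((hasDerivAt_id (0 : ℝ)).prodMk (hasDerivAt_const (0 : ℝ) s))
  -- With the translation applied last, the curve is `(t, s)`; its velocity is split into the
  -- directions of `Y` and `X` at `translation s • T`.
  have h2 : ((1, 0) : ℝ × ℝ) = (1, Real.log 2 * s) - (s * Real.log 2) • ((0, 1) : ℝ × ℝ) := by
    ext <;> simp [mul_comm]
  rw [h2, map_sub, map_smul] at this
  simp only [beta0, hf.fieldX_translation, hf.fieldY_translation]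
  simpa [beta0, beta1, Function.comp_def, ← mul_smul] using this

theorem IsLeafSmooth.fieldY_beta0 (hf : IsLeafSmooth f) (s : ℝ) (T : Hull w) :
    fieldY (beta0 s f) T = fieldY f (AffG.translation s • T) -
      s * Real.log 2 * fieldX f (AffG.translation s • T) :=
  (hf.hasDerivAt_beta1_beta0 s T).deriv

end

/-! ### Invariance of the measure under `Y` -/

/-- Bounded measurable functions on the hull with a bounded measurable derivative along `Y`. -/
structure HasBoundedY (a : Hull w → ℂ) : Prop where
  measurable : Measurable a
  bounded : ∃ C, ∀ T, ‖a T‖ ≤ C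
  hasDerivAt : ∀ T, HasDerivAt (fun t => a (AffG.dilation t • T)) (fieldY a T) 0
  measurable_fieldY : Measurable (fieldY a)
  bounded_fieldY : ∃ C, ∀ T, ‖fieldY a T‖ ≤ C

theorem exists_norm_mul_le {a b : Hull w → ℂ} (ha : ∃ C, ∀ T, ‖a T‖ ≤ C)
    (hb : ∃ C, ∀ T, ‖b T‖ ≤ C) : ∃ C, ∀ T, ‖a T * b T‖ ≤ C := by
  obtain ⟨A, hA⟩ := ha
  obtain ⟨B, hB⟩ := hb
  refine ⟨A * B, fun T => ?_⟩
  rw [norm_mul]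
  exact mul_le_mul (hA T) (hB T) (norm_nonneg _) ((norm_nonneg _).trans (hA T))

namespace HasBoundedY

variable {a b : Hull w → ℂ}

theorem hasDerivAt_mul (ha : HasBoundedY a) (hb : HasBoundedY b) (T : Hull w) :
    HasDerivAt (fun t => (a * b) (AffG.dilation t • T))
      (fieldY a T * b T + a T * fieldY b T) 0 := by
  have := (ha.hasDerivAt T).mul (hb.hasDerivAt T)
  rwa [AffG.dilation_zero, one_smul] at this

theorem fieldY_mul (ha : HasBoundedY a) (hb : HasBoundedY b) (T : Hull w) :
    fieldY (a * b) T = fieldY a T * b T + a T * fieldY b T :=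
  (ha.hasDerivAt_mul hb T).deriv

theorem mul (ha : HasBoundedY a) (hb : HasBoundedY b) : HasBoundedY (a * b) where
  measurable := ha.measurable.mul hb.measurable
  bounded := exists_norm_mul_le ha.bounded hb.bounded
  hasDerivAt T := by
    rw [ha.fieldY_mul hb]
    exact ha.hasDerivAt_mul hb T
  measurable_fieldY := by
    rw [funext (ha.fieldY_mul hb)]
    exact (ha.measurable_fieldY.mul hb.measurable).add (ha.measurable.mul hb.measurable_fieldY)
  bounded_fieldY := by
    obtain ⟨A, hA⟩ := exists_norm_mul_le ha.bounded_fieldY hb.bounded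
    obtain ⟨B, hB⟩ := exists_norm_mul_le ha.bounded hb.bounded_fieldY
    refine ⟨A + B, fun T => ?_⟩
    rw [ha.fieldY_mul hb]
    exact norm_add_le_of_le (hA T) (hB T)

theorem hasDerivAt_dilation (ha : HasBoundedY a) (T : Hull w) (s : ℝ) :
    HasDerivAt (fun t => a (AffG.dilation t • T)) (fieldY a (AffG.dilation s • T)) s := by
  have h := ha.hasDerivAt (AffG.dilation s • T)
  rw [← sub_self s] at h
  have h' := h.comp_sub_const s s
  simpa [← mul_smul, AffG.dilation_mul] using h'

theorem integrable {η : Measure (Hull w)} [IsFiniteMeasure η] (ha : Measurable a)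
    (hb : ∃ C, ∀ T, ‖a T‖ ≤ C) : Integrable a η := by
  obtain ⟨C, hC⟩ := hb
  exact Integrable.of_bound ha.aestronglyMeasurable C (Eventually.of_forall hC)

/-- The function `t ↦ ∫ a(R_{2^t} T) dη` is constant by invariance; differentiation under the
integral, dominated by the bound on `fieldY a`, computes its derivative at `0`. -/
theorem integral_fieldY {η : Measure (Hull w)} [IsProbabilityMeasure η]
    (hη : ∀ g : AffG, MeasurePreserving (fun T : Hull w => g • T) η η) (ha : HasBoundedY a) :
    ∫ T, fieldY a T ∂η = 0 := by
  obtain ⟨C, hC⟩ := ha.bounded_fieldY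
  have h := (hasDerivAt_integral_of_dominated_loc_of_deriv_le (μ := η) (x₀ := (0 : ℝ))
    (F := fun t T => a (AffG.dilation t • T))
    (F' := fun t T => fieldY a (AffG.dilation t • T)) (bound := fun _ => C) univ_mem
    (Eventually.of_forall fun t =>
      (ha.measurable.comp (hη (AffG.dilation t)).measurable).aestronglyMeasurable)
    (by simpa [AffG.dilation_zero] using integrable ha.measurable ha.bounded)
    (ha.measurable_fieldY.comp (hη (AffG.dilation 0)).measurable).aestronglyMeasurable
    (Eventually.of_forall fun T t _ => hC _) (integrable_const C)
    (Eventually.of_forall fun T t _ => ha.hasDerivAt_dilation T t)).2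
  simp only [integral_comp_action hη] at h
  exact h.unique (hasDerivAt_const _ _)

end HasBoundedY

theorem IsLeafSmooth.hasBoundedY_beta0 (hm : ∀ g : AffG, Measurable fun T : Hull w => g • T)
    {f : Hull w → ℂ} (hf : IsLeafSmooth f) (s : ℝ) : HasBoundedY (beta0 s f) where
  measurable := (hf.continuous 0 0).measurable.comp (hm _)
  bounded := by
    obtain ⟨C, hC⟩ := hf.bounded 0 0
    exact ⟨C, fun T => hC _⟩
  hasDerivAt T := by
    have := hf.hasDerivAt_beta1_beta0 s T
    exact this.differentiableAt.hasDerivAt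
  measurable_fieldY := by
    rw [funext (hf.fieldY_beta0 s)]
    exact ((hf.continuous 0 1).measurable.comp (hm _)).sub
      (((hf.continuous 1 0).measurable.comp (hm _)).const_mul _)
  bounded_fieldY := by
    obtain ⟨A, hA⟩ := hf.bounded 0 1
    obtain ⟨B, hB⟩ := hf.bounded 1 0
    refine ⟨A + ‖(s * Real.log 2 : ℂ)‖ * B, fun T => ?_⟩
    rw [hf.fieldY_beta0]
    refine norm_sub_le_of_le (hA _) ?_
    rw [norm_mul]
    exact mul_le_mul_of_nonneg_left (hB _) (norm_nonneg _)

/-! ### Elements of the smooth crossed product are rapidly decreasing curves -/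

theorem IsLeafSmooth.norm_le_leafNorm {f : Hull w → ℂ} (hf : IsLeafSmooth f) (p q : ℕ)
    (T : Hull w) : ‖fieldX^[p] (fieldY^[q] f) T‖ ≤ leafNorm p q f := by
  obtain ⟨C, hC⟩ := hf.bounded p q
  exact le_ciSup (f := fun T => ‖fieldX^[p] (fieldY^[q] f) T‖)
    ⟨C, by rintro _ ⟨T, rfl⟩; exact hC T⟩ T

/-- Differentiability in each semi-norm makes the curve continuous for the sup norm; uniform
convergence combined with continuity along orbits gives joint continuity. Linearity and orbit
continuity of the operator are hypotheses, so that one argument serves for the identity, `X` and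
`Y`. -/
theorem MemSmoothCrossedProduct.isRapid {f : ℝ → Hull w → ℂ} (hf : MemSmoothCrossedProduct f)
    (p q : ℕ)
    (hlin : ∀ (c : ℂ) (a b d : Hull w → ℂ), IsLeafSmooth a → IsLeafSmooth b → IsLeafSmooth d →
      fieldX^[p] (fieldY^[q] (c • (a - b) - d)) = c • (fieldX^[p] (fieldY^[q] a) -
        fieldX^[p] (fieldY^[q] b)) - fieldX^[p] (fieldY^[q] d))
    (hcont : ∀ (a : Hull w → ℂ) (T : Hull w), IsLeafSmooth a →
      Continuous fun s => fieldX^[p] (fieldY^[q] a) (AffG.translation s • T)) :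
    IsRapid fun t => fieldX^[p] (fieldY^[q] (f t)) := by
  obtain ⟨F, rfl, hs, hd, hb⟩ := hf
  refine ⟨fun T => ?_, fun t => ((hs 0 t).continuous p q).measurable, fun k => ?_⟩
  · have hunif : ∀ t, TendstoUniformly (fun t' => fieldX^[p] (fieldY^[q] (F 0 t')))
        (fieldX^[p] (fieldY^[q] (F 0 t))) (𝓝 t) := by
      intro t
      have hev : ∀ᶠ x : ℝ in 𝓝[≠] 0, ∀ T, ‖fieldX^[p] (fieldY^[q] (F 0 (t + x))) T -
          fieldX^[p] (fieldY^[q] (F 0 t)) T‖ ≤ |x| * (1 + leafNorm p q (F 1 t)) := by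
        filter_upwards [(hd 0 t p q).eventually (gt_mem_nhds one_pos), self_mem_nhdsWithin]
          with x hx hx0 T
        have hxc : (x : ℂ) ≠ 0 := by exact_mod_cast hx0
        have hl := hlin (x : ℂ)⁻¹ _ _ _ (hs 0 (t + x)) (hs 0 t) (hs 1 t)
        -- An unbounded real supremum is `0` by convention, so a small `leafNorm` bounds the values
        -- only once boundedness is known.
        have hbdd : BddAbove (Set.range fun T => ‖fieldX^[p] (fieldY^[q]
            ((x : ℂ)⁻¹ • (F 0 (t + x) - F 0 t) - F 1 t)) T‖) := by
          refine ⟨‖(x : ℂ)⁻¹‖ * (leafNorm p q (F 0 (t + x)) + leafNorm p q (F 0 t)) +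
            leafNorm p q (F 1 t), ?_⟩
          rintro _ ⟨T, rfl⟩
          simp only [hl, Pi.sub_apply, Pi.smul_apply, smul_eq_mul]
          refine norm_sub_le_of_le ?_ ((hs 1 t).norm_le_leafNorm p q T)
          rw [norm_mul]
          exact mul_le_mul_of_nonneg_left (norm_sub_le_of_le
            ((hs 0 (t + x)).norm_le_leafNorm p q T) ((hs 0 t).norm_le_leafNorm p q T))
            (norm_nonneg _)
        have h1 := (le_ciSup hbdd T).trans hx.le
        simp only [hl, Pi.sub_apply, Pi.smul_apply, smul_eq_mul] at h1
        have h2 := norm_le_norm_add_norm_sub' ((x : ℂ)⁻¹ * (fieldX^[p] (fieldY^[q]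
          (F 0 (t + x))) T - fieldX^[p] (fieldY^[q] (F 0 t)) T)) (fieldX^[p] (fieldY^[q] (F 1 t)) T)
        have h3 := (hs 1 t).norm_le_leafNorm p q T
        rw [norm_mul, norm_inv, Complex.norm_real, Real.norm_eq_abs] at h2
        rw [← inv_mul_le_iff₀ (abs_pos.2 hx0)]
        linarith
      have hev' : ∀ᶠ x : ℝ in 𝓝 0, ∀ T, ‖fieldX^[p] (fieldY^[q] (F 0 (t + x))) T -
          fieldX^[p] (fieldY^[q] (F 0 t)) T‖ ≤ |x| * (1 + leafNorm p q (F 1 t)) := by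
        filter_upwards [eventually_nhdsWithin_iff.1 hev] with x hx T
        rcases eq_or_ne x 0 with rfl | hx0
        · simp
        · exact hx hx0 T
      rw [Metric.tendstoUniformly_iff]
      intro ε hε
      rw [← map_add_left_nhds_zero t, eventually_map]
      have hsmall : Tendsto (fun x : ℝ => |x| * (1 + leafNorm p q (F 1 t))) (𝓝 0) (𝓝 0) :=
        Continuous.tendsto' (by fun_prop) _ _ (by simp)
      filter_upwards [hev', hsmall.eventually (gt_mem_nhds hε)] with x hx hxε T
      rw [dist_comm, dist_eq_norm]
      exact (hx T).trans_lt hxε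
    refine continuous_iff_continuousAt.2 fun x => ?_
    have hu : TendstoUniformly (fun (y : ℝ × ℝ) (s : ℝ) =>
        fieldX^[p] (fieldY^[q] (F 0 y.1)) (AffG.translation s • T))
        (fun s => fieldX^[p] (fieldY^[q] (F 0 x.1)) (AffG.translation s • T)) (𝓝 x) := by
      intro u hu
      filter_upwards [continuousAt_fst.eventually (hunif x.1 u hu)] with y hy s using hy _
    exact hu.tendsto_comp (hcont _ T (hs 0 x.1)).continuousAt continuousAt_snd
  · obtain ⟨C, hC⟩ := hb (2 * k) 0 p q
    refine ⟨C, fun t T => le_trans ?_ (hC t)⟩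
    have : (1 + t ^ 2) ^ (((2 * k : ℕ) : ℝ) / 2) = (1 + t ^ 2) ^ k := by
      rw [← Real.rpow_natCast (1 + t ^ 2) k]
      congr 1
      push_cast
      ring
    rw [this]
    exact mul_le_mul_of_nonneg_left ((hs 0 t).norm_le_leafNorm p q T) (by positivity)

theorem MemSmoothCrossedProduct.isLeafSmooth {f : ℝ → Hull w → ℂ}
    (hf : MemSmoothCrossedProduct f) (t : ℝ) : IsLeafSmooth (f t) := by
  obtain ⟨F, rfl, hs, -⟩ := hf
  exact hs 0 t

theorem MemSmoothCrossedProduct.isRapid_self {f : ℝ → Hull w → ℂ}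
    (hf : MemSmoothCrossedProduct f) : IsRapid f :=
  hf.isRapid 0 0 (fun _ _ _ _ _ _ _ => rfl) fun _ T ha => ha.continuous_translation T

theorem MemSmoothCrossedProduct.isRapid_tildeX {f : ℝ → Hull w → ℂ}
    (hf : MemSmoothCrossedProduct f) : IsRapid (tildeX f) := by
  have hx : ∀ {a : Hull w → ℂ}, IsLeafSmooth a → ∀ T,
      HasDerivAt (fun t => beta0 t a T) (fieldX a T) 0 := fun ha T =>
    (ha.hasDerivAt_beta0 T 0).differentiableAt.hasDerivAt
  exact hf.isRapid 1 0
    (fun c a b d ha hb hd => funext fun T =>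
      ((((hx ha T).sub (hx hb T)).const_mul c).sub (hx hd T)).deriv)
    fun _ T ha => ha.continuous_fieldX_translation T

theorem MemSmoothCrossedProduct.isRapid_tildeY {f : ℝ → Hull w → ℂ}
    (hf : MemSmoothCrossedProduct f) : IsRapid (tildeY f) := by
  have hy : ∀ {a : Hull w → ℂ}, IsLeafSmooth a → ∀ T,
      HasDerivAt (fun t => beta1 t a T) (fieldY a T) 0 := fun ha T => by
    have := ha.hasDerivAt_beta1_translation T 0
    simp only [AffG.translation_zero, one_smul] at this
    exact this.differentiableAt.hasDerivAt
  exact hf.isRapid 0 1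
    (fun c a b d ha hb hd => funext fun T =>
      ((((hy ha T).sub (hy hb T)).const_mul c).sub (hy hd T)).deriv)
    fun _ T ha => ha.continuous_fieldY_translation T

/-! ### The cocycle `τ` on translated functions -/

section

variable {η : Measure (Hull w)} {F G H : ℝ → Hull w → ℂ}

theorem integrable_triple_integrand [IsFiniteMeasure η]
    (hm : ∀ g : AffG, Measurable fun T : Hull w => g • T)
    (hF : IsRapid F) (hG : IsRapid G) (hH : IsRapid H) (t : Fin 2 → ℝ) :
    Integrable (fun T => F (-(t 0 + t 1)) T * G (t 0) (AffG.translation (-(t 0 + t 1)) • T) *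
      H (t 1) (AffG.translation (-t 1) • T)) η := by
  obtain ⟨C, hC⟩ := exists_bound_tripleIntegrand hF hG hH
  have h := HasBoundedY.integrable (η := η)
    ((measurable_tripleIntegrand hm hF hG hH).comp
      (measurable_prodMk_right (y := tripleEquiv t))) ⟨_, fun T => hC T (tripleEquiv t)⟩
  have h1 : -t 1 - -(t 0 + t 1) = t 0 := by ring
  simpa only [Function.comp_def, tripleEquiv_apply, tripleIntegrand, h1, neg_neg] using h

/-- At a fixed point of the plane `derivZ` is multiplication by a scalar; this turns identities
between products with `derivZ` into polynomial identities in `t`. -/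
theorem triple_derivZ_left (t : Fin 2 → ℝ) :
    triple η (derivZ F) G H t = -(t 0 + t 1) * triple η F G H t := by
  unfold triple
  rw [← integral_const_mul]
  congr 1
  funext T
  simp only [derivZ, Pi.smul_apply, smul_eq_mul]
  push_cast
  ring

theorem triple_derivZ_mid (t : Fin 2 → ℝ) :
    triple η F (derivZ G) H t = t 0 * triple η F G H t := by
  unfold triple
  rw [← integral_const_mul]
  congr 1
  funext T
  simp only [derivZ, Pi.smul_apply, smul_eq_mul]
  ring

theorem triple_derivZ_right (t : Fin 2 → ℝ) :
    triple η F G (derivZ H) t = t 1 * triple η F G H t := by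
  unfold triple
  rw [← integral_const_mul]
  congr 1
  funext T
  simp only [derivZ, Pi.smul_apply, smul_eq_mul]
  ring

theorem beta0_translation (s u : ℝ) (a : Hull w → ℂ) (T : Hull w) :
    beta0 (s - u) a (AffG.translation u • T) = a (AffG.translation s • T) := by
  rw [beta0, ← mul_smul, AffG.translation_mul, sub_add_cancel]

theorem beta0_neg_translation (u : ℝ) (a : Hull w → ℂ) (T : Hull w) :
    beta0 (-u) a (AffG.translation u • T) = a T := by
  rw [← zero_sub, beta0_translation, AffG.translation_zero, one_smul]

variable {f g h : ℝ → Hull w → ℂ}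

/-- Translating the integration variable by `u` cancels every shift; what remains of `u` is the
commutator term of `Y` with `β⁰_{-u}`. -/
theorem tau_translate_left [IsProbabilityMeasure η]
    (hη : ∀ g : AffG, MeasurePreserving (fun T : Hull w => g • T) η η)
    (hf : MemSmoothCrossedProduct f) (hg : MemSmoothCrossedProduct g)
    (hh : MemSmoothCrossedProduct h) (t : Fin 2 → ℝ) (u : ℝ) :
    tau η ![beta0 (-u) (f (-(t 0 + t 1))),
        beta0 (-(t 0 + t 1) - u) (g (t 0)) * beta0 (-t 1 - u) (h (t 1))] =
      triple η (tildeY f) g h t + u * (Real.log 2 * triple η (tildeX f) g h t) := by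
  have hm := fun k => (hη k).measurable
  have hY := integrable_triple_integrand (η := η) hm hf.isRapid_tildeY hg.isRapid_self
    hh.isRapid_self t
  have hX := integrable_triple_integrand (η := η) hm hf.isRapid_tildeX hg.isRapid_self
    hh.isRapid_self t
  have hl := (hf.isLeafSmooth (-(t 0 + t 1))).fieldY_beta0 (-u)
  have h0 : ∀ (a : Hull w → ℂ) (T : Hull w),
      a (AffG.translation (-u) • AffG.translation u • T) = a T := beta0_neg_translation u
  rw [tau_pair, ← integral_comp_action hη (AffG.translation u), ← mul_assoc]
  unfold triple
  rw [← integral_const_mul, ← integral_add hY (hX.const_mul _)]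
  congr 1
  funext T
  simp only [Pi.mul_apply, beta0_translation, hl, h0, tildeX, tildeY]
  push_cast
  ring

/-- Integration by parts puts `Y` on the third function alone, whose shift is `-t 1 - u`; the
commutator therefore contributes the factor `t 1 + u`. -/
theorem tau_translate_right [IsProbabilityMeasure η]
    (hη : ∀ g : AffG, MeasurePreserving (fun T : Hull w => g • T) η η)
    (hf : MemSmoothCrossedProduct f) (hg : MemSmoothCrossedProduct g)
    (hh : MemSmoothCrossedProduct h) (t : Fin 2 → ℝ) (u : ℝ) :
    tau η ![beta0 (-u) (f (-(t 0 + t 1))) * beta0 (-(t 0 + t 1) - u) (g (t 0)),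
        beta0 (-t 1 - u) (h (t 1))] =
      -(triple η f g (tildeY h) t + t 1 * (Real.log 2 * triple η f g (tildeX h) t)) -
        u * (Real.log 2 * triple η f g (tildeX h) t) := by
  have hm := fun k => (hη k).measurable
  have hY := integrable_triple_integrand (η := η) hm hf.isRapid_self hg.isRapid_self
    hh.isRapid_tildeY t
  have hX := integrable_triple_integrand (η := η) hm hf.isRapid_self hg.isRapid_self
    hh.isRapid_tildeX t
  have hl := (hh.isLeafSmooth (t 1)).fieldY_beta0 (-t 1 - u)
  have h0 : ∀ (a : Hull w → ℂ) (T : Hull w), a (AffG.translation (-t 1 - u) •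
      AffG.translation u • T) = a (AffG.translation (-t 1) • T) := beta0_translation (-t 1) u
  have hab := ((hf.isLeafSmooth (-(t 0 + t 1))).hasBoundedY_beta0 hm (-u)).mul
    ((hg.isLeafSmooth (t 0)).hasBoundedY_beta0 hm (-(t 0 + t 1) - u))
  have hc := (hh.isLeafSmooth (t 1)).hasBoundedY_beta0 hm (-t 1 - u)
  have hst := (hab.mul hc).integral_fieldY hη
  simp only [hab.fieldY_mul hc] at hst
  rw [integral_add] at hst
  rotate_left
  · exact HasBoundedY.integrable (hab.measurable_fieldY.mul hc.measurable)
      (exists_norm_mul_le hab.bounded_fieldY hc.bounded)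
  · exact HasBoundedY.integrable (hab.measurable.mul hc.measurable_fieldY)
      (exists_norm_mul_le hab.bounded hc.bounded_fieldY)
  have key : ∫ T, (beta0 (-u) (f (-(t 0 + t 1))) * beta0 (-(t 0 + t 1) - u) (g (t 0))) T *
      fieldY (beta0 (-t 1 - u) (h (t 1))) T ∂η = triple η f g (tildeY h) t +
        (t 1 + u) * Real.log 2 * triple η f g (tildeX h) t := by
    rw [← integral_comp_action hη (AffG.translation u)]
    unfold triple
    rw [← integral_const_mul, ← integral_add hY (hX.const_mul _)]
    congr 1
    funext T
    simp only [Pi.mul_apply, beta0_translation, beta0_neg_translation, hl, h0, tildeX, tildeY]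
    push_cast
    ring
  rw [tau_pair, eq_neg_of_add_eq_zero_left hst, key]
  ring

theorem intervalIntegral_affine (a b : ℝ) (A B : ℂ) :
    ∫ u in a..b, (A + u * B) = (b - a) * A + (b ^ 2 - a ^ 2) / 2 * B := by
  rw [intervalIntegral.integral_add (by simp)
    (Continuous.intervalIntegrable (by fun_prop) _ _), intervalIntegral.integral_const,
    intervalIntegral.integral_mul_const, intervalIntegral.integral_ofReal, integral_id,
    Complex.real_smul]
  push_cast
  ring

end

/-! ### Assembling the formula -/

theorem sh_tau (η : Measure (Hull w)) [IsProbabilityMeasure η]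
    (hη : ∀ g : AffG, MeasurePreserving (fun T : Hull w => g • T) η η)
    (f g h : ℝ → Hull w → ℂ) (hf : MemSmoothCrossedProduct f) (hg : MemSmoothCrossedProduct g)
    (hh : MemSmoothCrossedProduct h) :
    sh beta0 (tau η) ![f, g, h] =
      -(2 * Real.pi * Complex.I) *
          (evalZero η (conv (conv (tildeY f) g) (derivZ h))
            - evalZero η (conv (conv (derivZ f) g) (tildeY h)))
        - 2 * Real.pi * Complex.I * Real.log 2 *
          (1 / 2 * evalZero η (conv (conv (derivZ (derivZ f)) g) (tildeX h))
            + evalZero η (conv (conv (derivZ f) (derivZ g)) (tildeX h))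
            - 1 / 2 * evalZero η (conv (conv (tildeX f) g) (derivZ (derivZ h)))) := by
  have hm := fun k => (hη k).measurable
  have f0 := hf.isRapid_self
  have g0 := hg.isRapid_self
  have h0 := hh.isRapid_self
  have fX := hf.isRapid_tildeX
  have fY := hf.isRapid_tildeY
  have hX := hh.isRapid_tildeX
  have hY := hh.isRapid_tildeY
  have i : ∀ {F G H : ℝ → Hull w → ℂ}, IsRapid F → IsRapid G → IsRapid H →
      Integrable (triple η F G H) := fun hF hG hH => integrable_triple hm hF hG hH
  have e1 : ∀ t : Fin 2 → ℝ, (∫ u in (-(t 0 + t 1))..(-t 1),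
      tau η ![beta0 (-u) (f (-(t 0 + t 1))) * beta0 (-(t 0 + t 1) - u) (g (t 0)),
        beta0 (-t 1 - u) (h (t 1))]) = -triple η f (derivZ g) (tildeY h) t +
          Real.log 2 / 2 * triple η f (derivZ (derivZ g)) (tildeX h) t := by
    intro t
    simp only [tau_translate_right hη hf hg hh, sub_eq_add_neg _ ((_ : ℂ) * _), ← mul_neg,
      intervalIntegral_affine, triple_derivZ_mid]
    push_cast
    ring
  have e2 : ∀ t : Fin 2 → ℝ, (∫ u in (-t 1)..0,
      (tau η ![beta0 (-u) (f (-(t 0 + t 1))),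
        beta0 (-(t 0 + t 1) - u) (g (t 0)) * beta0 (-t 1 - u) (h (t 1))] -
      tau η ![beta0 (-u) (f (-(t 0 + t 1))) * beta0 (-(t 0 + t 1) - u) (g (t 0)),
        beta0 (-t 1 - u) (h (t 1))])) = triple η (tildeY f) g (derivZ h) t +
          triple η f g (derivZ (tildeY h)) t - Real.log 2 / 2 *
          (triple η (tildeX f) g (derivZ (derivZ h)) t -
            triple η f g (derivZ (derivZ (tildeX h))) t) := by
    intro t
    have hi : ∀ u : ℝ, tau η ![beta0 (-u) (f (-(t 0 + t 1))),
        beta0 (-(t 0 + t 1) - u) (g (t 0)) * beta0 (-t 1 - u) (h (t 1))] -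
      tau η ![beta0 (-u) (f (-(t 0 + t 1))) * beta0 (-(t 0 + t 1) - u) (g (t 0)),
        beta0 (-t 1 - u) (h (t 1))] = (triple η (tildeY f) g h t + triple η f g (tildeY h) t +
          t 1 * (Real.log 2 * triple η f g (tildeX h) t)) + u * (Real.log 2 *
          (triple η (tildeX f) g h t + triple η f g (tildeX h) t)) := by
      intro u
      rw [tau_translate_left hη hf hg hh, tau_translate_right hη hf hg hh]
      ring
    simp only [hi, intervalIntegral_affine, triple_derivZ_right]
    push_cast
    ring
  rw [sh_one_cochain]
  simp only [e1, e2]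
  set A := triple η (tildeY f) g (derivZ h) with hA
  set B := triple η (derivZ f) g (tildeY h) with hB
  set C := triple η (derivZ (derivZ f)) g (tildeX h) with hC
  set D := triple η (derivZ f) (derivZ g) (tildeX h) with hD
  set E := triple η (tildeX f) g (derivZ (derivZ h)) with hE
  have iA : Integrable A := i fY g0 h0.derivZ
  have iB : Integrable B := i f0.derivZ g0 hY
  have iC : Integrable C := i f0.derivZ.derivZ g0 hX
  have iD : Integrable D := i f0.derivZ g0.derivZ hX
  have iE : Integrable E := i fX g0 h0.derivZ.derivZ
  have iL : Integrable fun t => -triple η f (derivZ g) (tildeY h) t +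
      Real.log 2 / 2 * triple η f (derivZ (derivZ g)) (tildeX h) t :=
    (i f0 g0.derivZ hY).neg.add ((i f0 g0.derivZ.derivZ hX).const_mul _)
  have iR : Integrable fun t => A t + triple η f g (derivZ (tildeY h)) t - Real.log 2 / 2 *
      (E t - triple η f g (derivZ (derivZ (tildeX h))) t) :=
    (iA.add (i f0 g0 hY.derivZ)).sub ((iE.sub (i f0 g0 hX.derivZ.derivZ)).const_mul _)
  have hsum : ∫ t, (-(A t - B t) - Real.log 2 * (1 / 2 * C t + D t - 1 / 2 * E t)) =
      -((∫ t, A t) - ∫ t, B t) -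
        Real.log 2 * (1 / 2 * (∫ t, C t) + (∫ t, D t) - 1 / 2 * ∫ t, E t) := by
    have iCD : Integrable fun t => 1 / 2 * C t + D t := (iC.const_mul _).add iD
    have iCDE : Integrable fun t => 1 / 2 * C t + D t - 1 / 2 * E t :=
      iCD.sub (iE.const_mul _)
    have iAB : Integrable fun t => -(A t - B t) := (iA.sub iB).neg
    rw [integral_sub iAB (iCDE.const_mul _), integral_neg, integral_sub iA iB,
      integral_const_mul, integral_sub iCD (iE.const_mul _), integral_add (iC.const_mul _) iD,
      integral_const_mul, integral_const_mul]
  rw [← integral_sub iL iR,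
    evalZero_conv_conv hm fY g0 h0.derivZ, evalZero_conv_conv hm f0.derivZ g0 hY,
    evalZero_conv_conv hm f0.derivZ.derivZ g0 hX, evalZero_conv_conv hm f0.derivZ g0.derivZ hX,
    evalZero_conv_conv hm fX g0 h0.derivZ.derivZ]
  refine Eq.trans ?_ ((congrArg (2 * Real.pi * Complex.I * ·) hsum).trans (by ring))
  congr 2
  funext t
  -- The `Y`-terms match as `-t₁ - t₂ = t₀`, where `t₁`, `t₂` are `t 0`, `t 1`. For the `X h`-terms
  -- the identity is `(t₁² - t₂²)/2 = t₁(t₁ + t₂) - (t₁ + t₂)²/2`.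
  simp only [hA, hB, hC, hD, hE, triple_derivZ_left, triple_derivZ_mid, triple_derivZ_right]
  ring

end PenroseHull

end

theorem mainTheorem9 {r : ℕ} (w : ℤ → Fin r)
    (η : MeasureTheory.Measure (PenroseHull.Hull w)) [MeasureTheory.IsProbabilityMeasure η]
    (hη : ∀ g : PenroseHull.AffG,
      MeasureTheory.MeasurePreserving (fun T : PenroseHull.Hull w => g • T) η η)
    (f g h : ℝ → PenroseHull.Hull w → ℂ)
    (hf : PenroseHull.MemSmoothCrossedProduct f)
    (hg : PenroseHull.MemSmoothCrossedProduct g)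
    (hh : PenroseHull.MemSmoothCrossedProduct h) :
    PenroseHull.sh PenroseHull.beta0 (PenroseHull.tau η) ![f, g, h] =
      -(2 * Real.pi * Complex.I) *
          (PenroseHull.evalZero η (PenroseHull.conv
              (PenroseHull.conv (PenroseHull.tildeY f) g) (PenroseHull.derivZ h))
            - PenroseHull.evalZero η (PenroseHull.conv
              (PenroseHull.conv (PenroseHull.derivZ f) g) (PenroseHull.tildeY h)))
        - 2 * Real.pi * Complex.I * Real.log 2 *
          (1 / 2 * PenroseHull.evalZero η (PenroseHull.conv
              (PenroseHull.conv (PenroseHull.derivZ (PenroseHull.derivZ f)) g)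
              (PenroseHull.tildeX h))
            + PenroseHull.evalZero η (PenroseHull.conv
              (PenroseHull.conv (PenroseHull.derivZ f) (PenroseHull.derivZ g))
              (PenroseHull.tildeX h))
            - 1 / 2 * PenroseHull.evalZero η (PenroseHull.conv
              (PenroseHull.conv (PenroseHull.tildeX f) g)
              (PenroseHull.derivZ (PenroseHull.derivZ h)))) ∧
    ∀ t : ℝ,
      PenroseHull.sh PenroseHull.beta0 (PenroseHull.tau η)
          ![PenroseHull.beta1Crossed t f, PenroseHull.beta1Crossed t g,
            PenroseHull.beta1Crossed t h] =
        PenroseHull.sh PenroseHull.beta0 (PenroseHull.tau η) ![f, g, h] :=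
  ⟨PenroseHull.sh_tau η hη f g h hf hg hh,
    fun t => PenroseHull.sh_tau_beta1Crossed hη t f g h⟩
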